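/- Let a toric diagram be a convex polygon $P\subset\mathbb R^2\times\{1\}\subset\mathbb R^3$ of dimension two whose vertices are lattice points $v_1,\dots,v_n\in\mathbb Z^2\times\{1\}$, listed in counter-clockwise order (so $\det(v_i,v_j,v_k)>0$ for $i<j<k$). Put $$\hat F_P(\phi)=\sum_{1\le i<j<k\le n}|\det(v_i,v_j,v_k)|\,\phi^i\phi^j\phi^k ,\qquad \phi=(\phi^1,\dots,\phi^n)\in\mathbb R^n .$$ Fix $r>0$, let $\Gamma_n=\{\phi\in\mathbb R^n:\phi^i\ge 0,\ \sum_i\phi^i=r\}$, with relative interior $\operatorname{relint}\Gamma_n=\{\phi\in\Gamma_n:\phi^i>0\text{ for all }i\}$, and let $F_P=\hat F_P|_{\Gamma_n}$. A point $\phi\in\operatorname{relint}\Gamma_n$ is a critical point of $F_P$ if $d\hat F_P(\phi)(w)=0$ for all $w\in\mathbb R^n$ with $\sum_i w^i=0$. Let $G$ be the group of all elements of $GL(3,\mathbb Z)$ that map the set $\mathbb Z^2\times\{1\}$ onto itself. Suppose that a nontrivial element $g$ of $G$ fixes $P$, i.e. $g(P)=P$. Then $g$ permutes the vertices of $P$,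 $g(v_i)=v_{\sigma(i)}$ for a permutation $\sigma$ of $\{1,\dots,n\}$, and so acts on $\mathbb R^n$ by permuting the coordinates, $(g\phi)^{\sigma(i)}=\phi^i$. The function $F_P$ has a unique critical point $\phi_*$ in $\operatorname{relint}\Gamma_n$; it is also the unique global maximizer of $F_P$ on $\Gamma_n$; and it is fixed by $g$: $g\phi_*=\phi_*$, i.e. $\phi_*^{\sigma(i)}=\phi_*^i$ for all $i$. Thus there is no spontaneous symmetry breaking in $a$-maximization. -/

import Mathlib

namespace ToricA

/-- The lattice points of the hyperplane at height one in `ℤ³`. -/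
def latticePlane : Set (Fin 3 → ℤ) := {x | x 2 = 1}

/-- A toric diagram: a two-dimensional convex integral polygon embedded into height one,
i.e. the convex hull in `ℝ³` of a finite set of lattice points `(*, *, 1)`, of dimension two. -/
def IsToricDiagram (P : Set (Fin 3 → ℝ)) : Prop :=
  (∃ S : Set (Fin 3 → ℤ), S.Finite ∧ S ⊆ latticePlane ∧
    P = convexHull ℝ ((fun (x : Fin 3 → ℤ) (i : Fin 3) => (x i : ℝ)) '' S)) ∧
  Module.finrank ℝ (vectorSpan ℝ P) = 2

/-- The determinant of the `3 × 3` matrix with columns `u`, `v`, `w`. -/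
def det3 (u v w : Fin 3 → ℝ) : ℝ := (Matrix.transpose (Matrix.of ![u, v, w])).det

/-- `v 0, …, v (n - 1)` are the vertices (extreme points) of `P`, in counter-clockwise order. -/
def IsVertexList (P : Set (Fin 3 → ℝ)) {n : ℕ} (v : Fin n → Fin 3 → ℝ) : Prop :=
  Set.range v = P.extremePoints ℝ ∧ ∀ i j k, i < j → j < k → 0 < det3 (v i) (v j) (v k)

/-- The group `G` of all elements of `GL(3, ℤ)` that leave invariant the set of lattice points
of the hyperplane at height one. -/
def affineGroup : Subgroup (GL (Fin 3) ℤ) where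
  carrier := {g | (fun x => g.1.mulVec x) '' latticePlane = latticePlane}
  one_mem' := by simp
  mul_mem' := by
    intro a b ha hb
    simp only [Set.mem_ofPred_eq] at ha hb ⊢
    calc (fun x => (a * b).1.mulVec x) '' latticePlane
        = (fun x => a.1.mulVec x) '' ((fun x => b.1.mulVec x) '' latticePlane) := by
          rw [Set.image_image]; simp [Matrix.mulVec_mulVec]
      _ = latticePlane := by rw [hb, ha]
  inv_mem' := by
    intro a ha
    simp only [Set.mem_ofPred_eq] at ha ⊢
    have h : (fun x => (a⁻¹).1.mulVec x) '' ((fun x => a.1.mulVec x) '' latticePlane)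
        = latticePlane := by
      rw [Set.image_image]
      have : ∀ x : Fin 3 → ℤ, (a⁻¹).1.mulVec (a.1.mulVec x) = x := by
        intro x
        rw [Matrix.mulVec_mulVec, ← Units.val_mul, inv_mul_cancel, Units.val_one,
          Matrix.one_mulVec]
      simp only [this, Set.image_id']
    rwa [ha] at h

/-- The linear action of an integral matrix `g ∈ GL(3, ℤ)` on `ℝ³`. -/
def act (g : GL (Fin 3) ℤ) (x : Fin 3 → ℝ) : Fin 3 → ℝ :=
  (g.1.map (fun a : ℤ => (a : ℝ))).mulVec x

/-- The homogeneous cubic polynomial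
`∑_{i < j < k} |det (v i, v j, v k)| φ i φ j φ k`. -/
def FHat {n : ℕ} (v : Fin n → Fin 3 → ℝ) (φ : Fin n → ℝ) : ℝ :=
  ∑ i, ∑ j ∈ Finset.Ioi i, ∑ k ∈ Finset.Ioi j, |det3 (v i) (v j) (v k)| * φ i * φ j * φ k

/-- The simplex `{φ ∈ ℝⁿ : φ i ≥ 0, ∑ φ i = r}`. -/
def simplex (n : ℕ) (r : ℝ) : Set (Fin n → ℝ) := {φ | (∀ i, 0 ≤ φ i) ∧ ∑ i, φ i = r}

/-- The relative interior `{φ ∈ ℝⁿ : φ i > 0, ∑ φ i = r}` of the simplex. -/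
def relintSimplex (n : ℕ) (r : ℝ) : Set (Fin n → ℝ) := {φ | (∀ i, 0 < φ i) ∧ ∑ i, φ i = r}

/-- `φ` is a critical point, in the relative interior of the simplex, of the restriction of `FHat v`
to the simplex: the differential of `FHat v` at `φ` vanishes on all tangent directions of the
simplex. -/
def IsCriticalPoint {n : ℕ} (v : Fin n → Fin 3 → ℝ) (r : ℝ) (φ : Fin n → ℝ) : Prop :=
  φ ∈ relintSimplex n r ∧ ∀ w : Fin n → ℝ, ∑ i, w i = 0 → fderiv ℝ (FHat v) φ w = 0

/-- The action of a permutation of the indices on `ℝⁿ`: the coordinate with index `i` becomes the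
coordinate with index `σ i`. -/
def permCoords {n : ℕ} (σ : Equiv.Perm (Fin n)) (φ : Fin n → ℝ) : Fin n → ℝ :=
  fun i => φ (σ.symm i)

end ToricA

/-!
The cubic form `FHat v` is the volume of the zonotope `∑ φ i • [0, v i]`, so its cube root is
concave by the Brunn–Minkowski inequality. What is needed of this is its infinitesimal form at
critical points: the Hessian of `FHat v` at an interior critical point is negative definite along
the simplex (`tri_neg_of_critical`). It is proved algebraically, in the style of Lorentzian
polynomials. The partial derivatives of `FHat v` are quadratic forms with coefficients
`|det (v m, v j, v k)|`, `m` fixed, and after a rescaling of the coordinates these become `|t j - t k|`, which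
is conditionally negative definite; so each has exactly one positive eigenvalue
(`bil_det3_lorentz`). Summing the resulting reverse Cauchy–Schwarz inequalities shows that the
eigenvalues of the suitably normalized Hessian are `≤ 0` or at least the Perron eigenvalue, which
is simple (`tri_neg_of_lorentz`).

Since `FHat v` is cubic, its second derivative along a segment is affine; if it is negative at
both ends, the first derivative cannot vanish at both, so there is at most one interior critical
point (`IsCriticalPoint.eq`). A maximizer exists by compactness and has positive coordinates
(`pos_of_isMaxOn`): the partial derivative with index `m` is the value at `v m` of a convex
function that is constant on the vertices in the support of the maximizer and is strictly larger
at every other vertex of a convex polygon. So there is exactly one maximizer, and it is the unique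
critical point. An element of `GL(3, ℤ)` preserving the polygon has determinant `±1` and permutes
the vertices, so it preserves `FHat v` and fixes the maximizer.
-/

namespace ToricA

/-! ### Quadratic forms with kernel `|t i - t j|` -/

/-- The gap between the two sides is `2 ∫ X ^ 2` over `(-∞, T]`, where `X τ` is the sum of the
`x i` with `t i ≤ τ`. Stated with a free upper bound `T`, the estimate passes from `s` to
`insert a s` when `t a` is maximal: take `T = t a` for `s`. -/
theorem energy_le {ι : Type*} [DecidableEq ι] (t x : ι → ℝ) (s : Finset ι) :
    (∀ T, (∀ i ∈ s, t i ≤ T) →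
      ∑ i ∈ s, ∑ j ∈ s, |t i - t j| * x i * x j
        ≤ 2 * (∑ i ∈ s, x i) * ∑ i ∈ s, x i * (T - t i)) ∧
    (Set.InjOn t s → ∀ T, (∀ i ∈ s, t i < T) →
      ∑ i ∈ s, ∑ j ∈ s, |t i - t j| * x i * x j
        = 2 * (∑ i ∈ s, x i) * ∑ i ∈ s, x i * (T - t i) → ∀ i ∈ s, x i = 0) := by
  induction s using Finset.induction_on_max_value t with
  | empty => simp
  | insert a s ha hmax ih =>
    obtain ⟨ih1, ih2⟩ := ih
    have hS : ∑ i ∈ insert a s, ∑ j ∈ insert a s, |t i - t j| * x i * x j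
        = ∑ i ∈ s, ∑ j ∈ s, |t i - t j| * x i * x j
          + 2 * x a * ∑ i ∈ s, x i * (t a - t i) := by
      simp only [Finset.sum_insert ha, sub_self, abs_zero, zero_mul, zero_add,
        Finset.sum_add_distrib]
      have h1 : ∑ j ∈ s, |t a - t j| * x a * x j = x a * ∑ i ∈ s, x i * (t a - t i) := by
        rw [Finset.mul_sum]
        refine Finset.sum_congr rfl fun j hj => ?_
        rw [abs_of_nonneg (sub_nonneg.2 (hmax j hj))]; ring
      have h2 : ∑ j ∈ s, |t j - t a| * x j * x a = x a * ∑ i ∈ s, x i * (t a - t i) := by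
        rw [← h1]
        refine Finset.sum_congr rfl fun j hj => ?_
        rw [abs_sub_comm]; ring
      rw [h1, h2]; ring
    have hL : ∀ T, ∑ i ∈ insert a s, x i * (T - t i)
        = ∑ i ∈ s, x i * (t a - t i) + (∑ i ∈ insert a s, x i) * (T - t a) := by
      intro T
      rw [Finset.sum_insert ha, Finset.sum_insert ha, add_mul, Finset.sum_mul, add_left_comm,
        ← Finset.sum_add_distrib]
      congr 1
      exact Finset.sum_congr rfl fun j _ => by ring
    have hE : ∀ T, 2 * (∑ i ∈ insert a s, x i) * ∑ i ∈ insert a s, x i * (T - t i)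
        - ∑ i ∈ insert a s, ∑ j ∈ insert a s, |t i - t j| * x i * x j
        = (2 * (∑ i ∈ s, x i) * ∑ i ∈ s, x i * (t a - t i)
            - ∑ i ∈ s, ∑ j ∈ s, |t i - t j| * x i * x j)
          + 2 * (∑ i ∈ insert a s, x i) ^ 2 * (T - t a) := by
      intro T
      rw [hL, hS, Finset.sum_insert ha]; ring
    refine ⟨fun T hT => ?_, fun hinj T hT heq => ?_⟩
    · have h1 := hE T
      have h2 := ih1 (t a) hmax
      have h3 : 0 ≤ 2 * (∑ i ∈ insert a s, x i) ^ 2 * (T - t a) :=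
        mul_nonneg (by positivity) (sub_nonneg.2 (hT a (Finset.mem_insert_self a s)))
      linarith
    · have h1 := hE T
      have h2 := ih1 (t a) hmax
      have hTa : 0 < T - t a := sub_pos.2 (hT a (Finset.mem_insert_self a s))
      have h3 : 0 ≤ 2 * (∑ i ∈ insert a s, x i) ^ 2 * (T - t a) := by positivity
      have hlt : ∀ i ∈ s, t i < t a := fun i hi => lt_of_le_of_ne (hmax i hi) fun h =>
        ha (hinj (Finset.mem_insert_of_mem hi) (Finset.mem_insert_self a s) h ▸ hi)
      have hs : ∀ i ∈ s, x i = 0 :=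
        ih2 (hinj.mono (by simp)) (t a) hlt (by linarith)
      have h4 : 2 * (∑ i ∈ insert a s, x i) ^ 2 * (T - t a) = 0 := by linarith
      have h5 : ∑ i ∈ insert a s, x i = 0 := by
        simpa [hTa.ne'] using h4
      rw [Finset.sum_insert ha, Finset.sum_eq_zero hs, add_zero] at h5
      intro i hi
      rcases Finset.mem_insert.1 hi with rfl | hi
      exacts [h5, hs i hi]

/-- The kernel `|t i - t j|` is conditionally negative definite. -/
theorem sum_abs_sub_mul_nonpos {ι : Type*} [DecidableEq ι] (t x : ι → ℝ) (s : Finset ι)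
    (hx : ∑ i ∈ s, x i = 0) : ∑ i ∈ s, ∑ j ∈ s, |t i - t j| * x i * x j ≤ 0 := by
  obtain ⟨T, hT⟩ := (s.image t).bddAbove
  have := (energy_le t x s).1 T fun i hi => hT (by simpa using ⟨i, hi, rfl⟩)
  simpa [hx] using this

theorem eq_zero_of_sum_abs_sub_mul_eq_zero {ι : Type*} [DecidableEq ι] (t x : ι → ℝ)
    (s : Finset ι) (ht : Set.InjOn t s) (hx : ∑ i ∈ s, x i = 0)
    (h : ∑ i ∈ s, ∑ j ∈ s, |t i - t j| * x i * x j = 0) : ∀ i ∈ s, x i = 0 := by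
  obtain ⟨T, hT⟩ := (s.image t).bddAbove
  refine (energy_le t x s).2 ht (T + 1) (fun i hi => ?_) (by simp [h, hx])
  have : t i ≤ T := hT (by simpa using ⟨i, hi, rfl⟩)
  linarith

/-! ### Bilinear forms of arrays -/

/-- The bilinear form `∑ D j k x j y k` of the array `D`. -/
def bil {ι : Type*} [Fintype ι] (D : ι → ι → ℝ) (x y : ι → ℝ) : ℝ :=
  ∑ j, ∑ k, D j k * x j * y k

section bil
variable {ι : Type*} [Fintype ι] (D : ι → ι → ℝ) (x y z : ι → ℝ) (a : ℝ)

theorem bil_add_left : bil D (x + y) z = bil D x z + bil D y z := by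
  simp [bil, mul_add, add_mul, Finset.sum_add_distrib]

theorem bil_smul_left : bil D (a • x) z = a * bil D x z := by
  simp only [bil, Finset.mul_sum, Pi.smul_apply, smul_eq_mul]
  exact Finset.sum_congr rfl fun i _ => Finset.sum_congr rfl fun j _ => by ring

variable {D} in
theorem bil_comm (hD : ∀ j k, D j k = D k j) : bil D x y = bil D y x := by
  rw [bil, Finset.sum_comm, bil]
  refine Finset.sum_congr rfl fun i _ => Finset.sum_congr rfl fun j _ => ?_
  rw [hD]; ring

variable {D} in
theorem bil_add_smul_self (hD : ∀ j k, D j k = D k j) :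
    bil D (x + a • y) (x + a • y) = bil D x x + 2 * a * bil D x y + a ^ 2 * bil D y y := by
  rw [bil_add_left, bil_smul_left, bil_comm _ _ hD, bil_comm y _ hD, bil_add_left,
    bil_smul_left, bil_add_left, bil_smul_left, bil_comm y x hD]
  ring

theorem bil_pos_of_nonneg (hD : ∀ i j, 0 ≤ D i j) {i j : ι} (hij : 0 < D i j)
    (hx : ∀ i, 0 < x i) : 0 < bil D x x := by
  refine Finset.sum_pos' (fun i _ => Finset.sum_nonneg fun j _ => ?_) ⟨i, Finset.mem_univ _,
    Finset.sum_pos' (fun j _ => ?_) ⟨j, Finset.mem_univ _, ?_⟩⟩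
  · exact mul_nonneg (mul_nonneg (hD _ _) (hx _).le) (hx _).le
  · exact mul_nonneg (mul_nonneg (hD _ _) (hx _).le) (hx _).le
  · exact mul_pos (mul_pos hij (hx _)) (hx _)

end bil

/-- A form that is negative semidefinite on a hyperplane and positive at `φ` is negative
semidefinite on the orthogonal complement of `φ`, with all isotropic vectors of that complement in
the hyperplane. -/
theorem bil_nonpos_of_hyperplane {ι : Type*} [Fintype ι] {D : ι → ι → ℝ}
    (hD : ∀ j k, D j k = D k j) (l φ w : ι → ℝ) (hl : 0 < ∑ j, l j * φ j)
    (hneg : ∀ u : ι → ℝ, ∑ j, l j * u j = 0 → bil D u u ≤ 0)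
    (hφ : 0 < bil D φ φ) (hw : bil D φ w = 0) :
    bil D w w ≤ 0 ∧ (bil D w w = 0 → ∑ j, l j * w j = 0) := by
  set c : ℝ := (∑ j, l j * w j) / ∑ j, l j * φ j with hc
  have h1 : ∑ j, l j * (w + (-c) • φ) j = 0 := by
    simp only [Pi.add_apply, Pi.smul_apply, smul_eq_mul, mul_add, Finset.sum_add_distrib]
    have : ∑ j, l j * (-c * φ j) = -c * ∑ j, l j * φ j := by
      rw [Finset.mul_sum]; exact Finset.sum_congr rfl fun _ _ => by ring
    rw [this, hc]; field_simp; ring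
  have h2 := hneg _ h1
  rw [bil_add_smul_self _ _ _ hD, bil_comm w φ hD, hw] at h2
  have h3 : 0 ≤ c ^ 2 * bil D φ φ := by positivity
  refine ⟨by nlinarith, fun h0 => ?_⟩
  have h4 : c ^ 2 * bil D φ φ = 0 := by nlinarith
  have h5 : c = 0 := by simpa [hφ.ne'] using h4
  rw [hc, div_eq_zero_iff] at h5
  exact h5.resolve_right hl.ne'

/-! ### The quadratic slices of the determinant form are Lorentzian -/

theorem det3_eq (u v w : Fin 3 → ℝ) : det3 u v w =
    u 0 * v 1 * w 2 - u 0 * w 1 * v 2 - v 0 * u 1 * w 2 + v 0 * w 1 * u 2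
      + w 0 * u 1 * v 2 - w 0 * v 1 * u 2 := by
  rw [det3, Matrix.det_transpose, Matrix.det_fin_three]
  simp
  ring

/-- A three-term Plücker relation. -/
theorem det3_plucker (m y z a b : Fin 3 → ℝ) :
    det3 m z a * det3 m y b - det3 m z b * det3 m y a = det3 m z y * det3 m a b := by
  simp only [det3_eq]; ring

/-- The linear forms `z ↦ det (m, z, u i)`, if none is zero, have a common point where none
vanishes. -/
theorem exists_det3_ne_zero {ι : Type*} [Finite ι] (m : Fin 3 → ℝ) (u : ι → Fin 3 → ℝ)
    (hu : ∀ i, ∃ z, det3 m z (u i) ≠ 0) : ∃ z, ∀ i, det3 m z (u i) ≠ 0 := by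
  let f : ι → Module.Dual ℝ (Fin 3 → ℝ) := fun i =>
    { toFun := fun z => det3 m z (u i)
      map_add' := fun x y => by simp only [det3_eq, Pi.add_apply]; ring
      map_smul' := fun a x => by
        simp only [det3_eq, Pi.smul_apply, smul_eq_mul, RingHom.id_apply]
        ring }
  exact Module.Dual.exists_forall_ne_zero_of_forall_exists f hu

/-- The slice `|det (v m, v j, v k)|` with `m` fixed is Lorentzian, and nondegenerate in the
coordinates other than `m`. With a generic vector `z` and `s j = det (v m, z, v j)`, the Plücker
relation writes it as a multiple of `|s j| |s k| |t j - t k|`, which is conditionally negative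
definite. -/
theorem bil_det3_lorentz {ι : Type*} [Fintype ι] [DecidableEq ι] (v : ι → Fin 3 → ℝ) (m : ι)
    (hgen : ∀ j k, j ≠ m → k ≠ m → j ≠ k → det3 (v m) (v j) (v k) ≠ 0)
    (hcard : ∀ i, i ≠ m → ∃ k, k ≠ m ∧ k ≠ i) (hm : ∃ j, j ≠ m)
    (φ w : ι → ℝ) (hφ : ∀ i, 0 < φ i)
    (hw : bil (fun j k => |det3 (v m) (v j) (v k)|) φ w = 0) :
    bil (fun j k => |det3 (v m) (v j) (v k)|) w w ≤ 0 ∧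
      (bil (fun j k => |det3 (v m) (v j) (v k)|) w w = 0 → ∀ j, j ≠ m → w j = 0) := by
  obtain ⟨p, hp⟩ := hm
  obtain ⟨z, hz⟩ := exists_det3_ne_zero (v m) (fun i : {i // i ≠ m} => v i) (by
    rintro ⟨i, hi⟩
    obtain ⟨k, hk, hki⟩ := hcard i hi
    exact ⟨v k, hgen k i hk hi hki⟩)
  replace hz : ∀ i, i ≠ m → det3 (v m) z (v i) ≠ 0 := fun i hi => hz ⟨i, hi⟩
  set D : ι → ι → ℝ := fun j k => |det3 (v m) (v j) (v k)| with hDdef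
  set s : ι → ℝ := fun j => det3 (v m) z (v j) with hs
  set t : ι → ℝ := fun j => det3 (v m) (v p) (v j) / s j with ht
  have hsm : s m = 0 := by simp only [hs, det3_eq]; ring
  have hsp : s p ≠ 0 := hz p hp
  have hst : ∀ j k, j ≠ m → k ≠ m →
      s p * det3 (v m) (v j) (v k) = s j * s k * (t k - t j) := by
    intro j k hj hk
    have hj' : s j ≠ 0 := hz j hj
    have hk' : s k ≠ 0 := hz k hk
    rw [← det3_plucker]
    simp only [ht]
    field_simp
    simp only [hs]
    ring
  have hD : ∀ j k, |s p| * D j k = |t j - t k| * |s j| * |s k| := by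
    intro j k
    by_cases hj : j = m
    · subst hj
      have : D j k = 0 := by simp only [hDdef, det3_eq, abs_eq_zero]; ring
      simp [this, hsm]
    by_cases hk : k = m
    · subst hk
      have : D j k = 0 := by simp only [hDdef, det3_eq, abs_eq_zero]; ring
      simp [this, hsm]
    rw [← abs_mul, hst j k hj hk, abs_mul, abs_mul, abs_sub_comm]
    ring
  have hDsymm : ∀ j k, D j k = D k j := by
    intro j k
    simp only [hDdef]
    rw [← abs_neg]; congr 1; simp only [det3_eq]; ring
  have hbil : ∀ u : ι → ℝ, |s p| * bil D u u = ∑ i ∈ Finset.univ.erase m,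
      ∑ j ∈ Finset.univ.erase m, |t i - t j| * (|s i| * u i) * (|s j| * u j) := by
    intro u
    rw [Finset.sum_erase]
    · rw [bil, Finset.mul_sum]
      refine Finset.sum_congr rfl fun i _ => ?_
      rw [Finset.sum_erase]
      · rw [Finset.mul_sum]
        refine Finset.sum_congr rfl fun j _ => ?_
        linear_combination u i * u j * hD i j
      · simp [hsm]
    · simp [hsm]
  have hsum : ∀ u : ι → ℝ, ∑ j, |s j| * u j = ∑ j ∈ Finset.univ.erase m, |s j| * u j := by
    intro u
    rw [Finset.sum_erase]; simp [hsm]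
  have hsp' : 0 < |s p| := abs_pos.2 hsp
  obtain ⟨k, hk, hkp⟩ := hcard p hp
  have hφD : 0 < bil D φ φ :=
    bil_pos_of_nonneg D φ (fun _ _ => abs_nonneg _)
      (abs_pos.2 (hgen p k hp hk hkp.symm)) hφ
  have key := bil_nonpos_of_hyperplane hDsymm (fun j => |s j|) φ w
    (Finset.sum_pos' (fun i _ => mul_nonneg (abs_nonneg _) (hφ i).le)
      ⟨p, Finset.mem_univ _, mul_pos hsp' (hφ p)⟩)
    (fun u hu => by
      rw [hsum] at hu
      have := sum_abs_sub_mul_nonpos t (fun j => |s j| * u j) _ hu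
      rw [← hbil] at this
      exact nonpos_of_mul_nonpos_right this hsp') hφD hw
  refine ⟨key.1, fun h0 j hj => ?_⟩
  have hw0 := key.2 h0
  rw [hsum] at hw0
  have hinj : Set.InjOn t (Finset.univ.erase m : Finset ι) := by
    intro a ha b hb hab
    by_contra hne
    simp only [Finset.coe_erase, Finset.coe_univ, Set.mem_sdiff, Set.mem_univ, true_and,
      Set.mem_singleton_iff] at ha hb
    have := hst a b ha hb
    rw [hab, sub_self, mul_zero] at this
    exact (mul_ne_zero hsp (hgen a b ha hb hne)) this
  have := eq_zero_of_sum_abs_sub_mul_eq_zero t (fun j => |s j| * w j) _ hinj hw0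
    (by rw [← hbil, h0, mul_zero]) j (by simp [hj])
  exact (mul_eq_zero.1 this).resolve_left (abs_ne_zero.2 (hz j hj))

/-! ### From Lorentzian slices to a Lorentzian Hessian -/

open scoped InnerProductSpace in
/-- A symmetric operator whose eigenvectors all belong to negative eigenvalues or to the line
spanned by `u` is negative definite on the orthogonal complement of `u`. -/
theorem inner_map_neg_of_eigenvectors {E : Type*} [NormedAddCommGroup E] [InnerProductSpace ℝ E]
    [FiniteDimensional ℝ E] {T : E →ₗ[ℝ] E} (hT : T.IsSymmetric) (u : E)
    (h : ∀ (a : ℝ) (x : E), x ≠ 0 → T x = a • x → a < 0 ∨ ∃ b : ℝ, x = b • u)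
    (w : E) (hw : w ≠ 0) (huw : ⟪u, w⟫_ℝ = 0) : ⟪w, T w⟫_ℝ < 0 := by
  set b := hT.eigenvectorBasis rfl with hb
  have hsum : ⟪w, T w⟫_ℝ = ∑ i, hT.eigenvalues rfl i * ⟪b i, w⟫_ℝ ^ 2 := by
    rw [← b.sum_inner_mul_inner w (T w)]
    refine Finset.sum_congr rfl fun i _ => ?_
    rw [← hT (b i) w, hb, hT.apply_eigenvectorBasis, ← hb]
    simp only [RCLike.ofReal_real_eq_id, id]
    rw [real_inner_smul_left, real_inner_comm (b i) w]
    ring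
  have hterm : ∀ i, ⟪b i, w⟫_ℝ ≠ 0 → hT.eigenvalues rfl i < 0 := by
    intro i hi
    rcases h (hT.eigenvalues rfl i) (b i) (b.orthonormal.ne_zero i)
      (by rw [hb, hT.apply_eigenvectorBasis]; rfl) with h | ⟨c, hc⟩
    · exact h
    · rw [hc, real_inner_smul_left, huw, mul_zero] at hi
      exact absurd rfl hi
  have hex : ∃ i, ⟪b i, w⟫_ℝ ≠ 0 := by
    by_contra! hall
    apply hw
    rw [← b.sum_repr' w]
    simp [hall]
  rw [hsum]
  obtain ⟨i, hi⟩ := hex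
  refine Finset.sum_neg' (fun j _ => ?_) ⟨i, Finset.mem_univ _, ?_⟩
  · by_cases hj : ⟪b j, w⟫_ℝ = 0
    · simp [hj]
    · exact mul_nonpos_of_nonpos_of_nonneg (hterm j hj).le (sq_nonneg _)
  · exact mul_neg_of_neg_of_pos (hterm i hi) (by positivity)

section cubic
variable {ι : Type*} [Fintype ι]

/-- The trilinear form `∑ D i j k x i y j z k`. -/
def tri (D : ι → ι → ι → ℝ) (x y z : ι → ℝ) : ℝ := ∑ i, x i * bil (D i) y z

variable {D : ι → ι → ι → ℝ} (h12 : ∀ i j k, D i j k = D j i k) (h23 : ∀ i j k, D i j k = D i k j)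

theorem tri_add_left (x y z w : ι → ℝ) : tri D (x + y) z w = tri D x z w + tri D y z w := by
  simp [tri, add_mul, Finset.sum_add_distrib]

theorem tri_smul_left (a : ℝ) (x z w : ι → ℝ) : tri D (a • x) z w = a * tri D x z w := by
  simp [tri, Finset.mul_sum, mul_assoc]

include h12 in
theorem tri_comm_left (x y z : ι → ℝ) : tri D x y z = tri D y x z := by
  simp only [tri, bil, Finset.mul_sum]
  rw [Finset.sum_comm]
  refine Finset.sum_congr rfl fun i _ => Finset.sum_congr rfl fun j _ =>
    Finset.sum_congr rfl fun k _ => ?_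
  rw [h12]; ring

include h23 in
theorem tri_comm_right (x y z : ι → ℝ) : tri D x y z = tri D x z y :=
  Finset.sum_congr rfl fun i _ => by rw [bil_comm _ _ (h23 i)]

include h12 h23 in
theorem tri_add_smul_self (x y : ι → ℝ) (t : ℝ) :
    tri D (x + t • y) (x + t • y) (x + t • y) =
      tri D x x x + t * (3 * tri D y x x) + t ^ 2 * (3 * tri D x y y) + t ^ 3 * tri D y y y := by
  have key : ∀ z, tri D z (x + t • y) (x + t • y) =
      tri D z x x + 2 * t * tri D z x y + t ^ 2 * tri D z y y := by
    intro z
    simp only [tri, bil_add_smul_self _ _ _ (h23 _), Finset.mul_sum, ← Finset.sum_add_distrib]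
    exact Finset.sum_congr rfl fun i _ => by ring
  rw [tri_add_left, tri_smul_left, key, key, tri_comm_right h23 x x y, tri_comm_left h12 x y x,
    tri_comm_left h12 y x y]
  ring

include h12 h23 in
theorem tri_sub_tri (x y : ι → ℝ) :
    tri D (y - x) y y - tri D (y - x) x x =
      tri D x (y - x) (y - x) + tri D y (y - x) (y - x) := by
  have key : tri D (y - x) y y = tri D (y - x) x x + 2 * tri D (y - x) x (y - x)
      + tri D (y - x) (y - x) (y - x) := by
    conv_lhs => rw [show y = x + (1 : ℝ) • (y - x) by simp]
    simp only [tri, bil_add_smul_self _ _ _ (h23 _), Finset.mul_sum, ← Finset.sum_add_distrib]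
    exact Finset.sum_congr rfl fun i _ => by simp; ring
  have h2 : tri D y (y - x) (y - x) = tri D x (y - x) (y - x) + tri D (y - x) (y - x) (y - x) := by
    rw [← tri_add_left]; simp
  rw [key, h2, tri_comm_left h12 x (y - x)]; ring

theorem tri_single [DecidableEq ι] (m : ι) (y z : ι → ℝ) :
    tri D (Pi.single m 1) y z = bil (D m) y z := by
  rw [tri, Finset.sum_eq_single m] <;> simp +contextual

end cubic

/-- The reverse Cauchy–Schwarz inequality for a form of Lorentzian signature. -/
theorem bil_mul_le_sq {ι : Type*} [Fintype ι] {D : ι → ι → ℝ}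
    (hD : ∀ j k, D j k = D k j) {φ : ι → ℝ} {c : ℝ} (hc : 0 < c) (hφ : bil D φ φ = c)
    (hneg : ∀ w, bil D φ w = 0 → bil D w w ≤ 0) (w : ι → ℝ) :
    c * bil D w w ≤ bil D φ w ^ 2 := by
  have h1 : bil D φ (w + (-(bil D φ w / c)) • φ) = 0 := by
    rw [bil_comm _ _ hD, bil_add_left, bil_smul_left, hφ, bil_comm _ _ hD]; field_simp; ring
  have h2 := hneg _ h1
  rw [bil_add_smul_self _ _ _ hD, bil_comm w φ hD, hφ] at h2
  have h3 : bil D w w - bil D φ w ^ 2 / c ≤ 0 := by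
    convert h2 using 1; field_simp; ring
  rw [sub_nonpos, le_div_iff₀ hc] at h3
  linarith

/-- If all the slices `D m` are Lorentzian, then so is the weighted slice `A = ∑ φ m • D m`, at a
point `φ` where the partial derivatives of the cubic form coincide. The generalized eigenvalues of
`A` with respect to the weights `1 / φ i` satisfy `c a ≤ a ^ 2`, by summing the reverse
Cauchy–Schwarz inequalities for the slices, and `a ≤ c`, with equality only for multiples of `φ`,
by a Perron–Frobenius argument. So all the other eigenvalues are nonpositive, and a kernel vector
is isotropic for every slice, hence zero. -/
theorem tri_neg_of_lorentz {ι : Type*} [Fintype ι] [DecidableEq ι] [Nontrivial ι]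
    {D : ι → ι → ι → ℝ}
    (h12 : ∀ i j k, D i j k = D j i k) (h23 : ∀ i j k, D i j k = D i k j)
    {φ : ι → ℝ} (hφ : ∀ i, 0 < φ i) {c : ℝ} (hc : 0 < c) (hcrit : ∀ m, bil (D m) φ φ = c)
    (hpos : ∀ i j, i ≠ j → 0 < ∑ k, D i j k * φ k)
    (hneg : ∀ m w, bil (D m) φ w = 0 →
      bil (D m) w w ≤ 0 ∧ (bil (D m) w w = 0 → ∀ j, j ≠ m → w j = 0))
    (w : ι → ℝ) (hw : w ≠ 0) (hsum : ∑ i, w i = 0) : tri D φ w w < 0 := by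
  set A : ι → ι → ℝ := fun i j => ∑ k, D i j k * φ k with hA
  have hAsymm : ∀ i j, A i j = A j i := fun i j =>
    Finset.sum_congr rfl fun k _ => by rw [h12]
  have hAbil : ∀ i u, ∑ j, A i j * u j = bil (D i) φ u := by
    intro i u
    rw [bil_comm _ _ (h23 i)]
    simp only [hA, bil, Finset.sum_mul]
    exact Finset.sum_congr rfl fun j _ => Finset.sum_congr rfl fun k _ => by ring
  have htri : ∀ u, tri D φ u u = ∑ i, u i * ∑ j, A i j * u j := by
    intro u
    rw [tri_comm_left h12]
    exact Finset.sum_congr rfl fun i _ => by rw [hAbil]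
  -- the eigenvalues of `A` with respect to the weights `1 / φ i`
  have eig : ∀ (a : ℝ) (u : ι → ℝ), u ≠ 0 → (∀ i, φ i * ∑ j, A i j * u j = a * u i) →
      a < 0 ∨ ∃ b : ℝ, ∀ i, u i = b * φ i := by
    intro a u hu hau
    have hAu : ∀ i, ∑ j, A i j * u j = a * u i / φ i := fun i => by
      rw [eq_div_iff (hφ i).ne', mul_comm, hau]
    set N : ℝ := ∑ i, u i ^ 2 / φ i with hN
    have hNpos : 0 < N := by
      obtain ⟨i, hi⟩ := Function.ne_iff.1 hu
      refine Finset.sum_pos' (fun j _ => div_nonneg (sq_nonneg _) (hφ j).le)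
        ⟨i, Finset.mem_univ _, div_pos (by simpa using sq_pos_of_ne_zero hi) (hφ i)⟩
    have h1 : tri D φ u u = a * N := by
      rw [htri, hN, Finset.mul_sum]
      exact Finset.sum_congr rfl fun i _ => by rw [hAu]; ring
    have h2 : c * (a * N) ≤ a ^ 2 * N := by
      rw [← h1, hN, tri, Finset.mul_sum, Finset.mul_sum]
      refine Finset.sum_le_sum fun i _ => ?_
      have := bil_mul_le_sq (h23 i) hc (hcrit i) (fun w h => (hneg i w h).1) u
      rw [← hAbil, hAu] at this
      calc c * (φ i * bil (D i) u u) = φ i * (c * bil (D i) u u) := by ring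
        _ ≤ φ i * (a * u i / φ i) ^ 2 := mul_le_mul_of_nonneg_left this (hφ i).le
        _ = _ := by have := (hφ i).ne'; field_simp
    have h3 : c * a ≤ a * a := by
      have : c * a * N ≤ a * a * N := by linarith
      exact le_of_mul_le_mul_right this hNpos
    -- the Dirichlet form of the quotient `u / φ`
    have h4 : ∑ i, ∑ j, A i j * φ i * φ j * (u i / φ i - u j / φ j) ^ 2 = 2 * ((c - a) * N) := by
      have e1 : ∀ i j, A i j * φ i * φ j * (u i / φ i - u j / φ j) ^ 2 =
          A i j * φ j * (u i ^ 2 / φ i) + A i j * φ i * (u j ^ 2 / φ j)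
            - 2 * (u i * (A i j * u j)) := by
        intro i j
        have := (hφ i).ne'; have := (hφ j).ne'
        field_simp
        ring
      have e2 : ∑ i, ∑ j, A i j * φ j * (u i ^ 2 / φ i) = c * N := by
        rw [hN, Finset.mul_sum]
        refine Finset.sum_congr rfl fun i _ => ?_
        rw [← Finset.sum_mul, hAbil, hcrit]
      have e3 : ∑ i, ∑ j, A i j * φ i * (u j ^ 2 / φ j) = c * N := by
        rw [← e2, Finset.sum_comm]
        exact Finset.sum_congr rfl fun i _ => Finset.sum_congr rfl fun j _ => by rw [hAsymm]
      have e4 : ∑ i, ∑ j, 2 * (u i * (A i j * u j)) = 2 * (a * N) := by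
        rw [← h1, htri]; simp only [← Finset.mul_sum]
      simp only [e1, Finset.sum_add_distrib, Finset.sum_sub_distrib, e2, e3, e4]
      ring
    have h5 : ∀ i j, 0 ≤ A i j * φ i * φ j * (u i / φ i - u j / φ j) ^ 2 := by
      intro i j
      rcases eq_or_ne i j with rfl | hij
      · simp
      · exact mul_nonneg (mul_pos (mul_pos (hpos i j hij) (hφ i)) (hφ j)).le (sq_nonneg _)
    rcases lt_trichotomy a 0 with ha | rfl | ha
    · exact Or.inl ha
    · -- a kernel vector of `A` is isotropic for all the forms `D m`
      exfalso
      have hAu0 : ∀ i, bil (D i) φ u = 0 := fun i => by rw [← hAbil, hAu]; simp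
      have h6 : ∀ i ∈ Finset.univ, φ i * bil (D i) u u = 0 := by
        rw [← Finset.sum_eq_zero_iff_of_nonpos fun i _ =>
          mul_nonpos_of_nonneg_of_nonpos (hφ i).le (hneg i u (hAu0 i)).1]
        simpa [tri] using h1
      apply hu
      ext j
      obtain ⟨m, hm⟩ := exists_ne j
      exact (hneg m u (hAu0 m)).2 ((mul_eq_zero.1 (h6 m (Finset.mem_univ _))).resolve_left
        (hφ m).ne') j hm.symm
    · have hca : c ≤ a := le_of_mul_le_mul_right h3 ha
      have h7 : ∑ i, ∑ j, A i j * φ i * φ j * (u i / φ i - u j / φ j) ^ 2 = 0 := by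
        refine le_antisymm ?_ (Finset.sum_nonneg fun i _ => Finset.sum_nonneg fun j _ => h5 i j)
        rw [h4]; nlinarith
      right
      obtain ⟨m, -⟩ := exists_pair_ne ι
      refine ⟨u m / φ m, fun i => ?_⟩
      rcases eq_or_ne i m with rfl | him
      · have := (hφ i).ne'; field_simp
      rw [Finset.sum_eq_zero_iff_of_nonneg fun i _ => Finset.sum_nonneg fun j _ => h5 i j] at h7
      have h8 := h7 i (Finset.mem_univ _)
      rw [Finset.sum_eq_zero_iff_of_nonneg fun j _ => h5 i j] at h8
      have h9 := h8 m (Finset.mem_univ _)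
      have h10 : u i / φ i - u m / φ m = 0 := by
        have := mul_pos (mul_pos (hpos i m him) (hφ i)) (hφ m)
        exact pow_eq_zero_iff two_ne_zero |>.1 ((mul_eq_zero.1 h9).resolve_left this.ne')
      rw [← sub_eq_zero.1 h10]
      have := (hφ i).ne'; field_simp
  -- symmetrize the eigenvalue problem by the square roots of the weights
  set q : ι → ℝ := fun i => √(φ i) with hq
  have hqpos : ∀ i, 0 < q i := fun i => Real.sqrt_pos.2 (hφ i)
  have hqq : ∀ i, q i * q i = φ i := fun i => Real.mul_self_sqrt (hφ i).le
  let B : Matrix ι ι ℝ := Matrix.of fun i j => q i * A i j * q j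
  have hB : (Matrix.toEuclideanLin B).IsSymmetric := by
    rw [Matrix.isSymmetric_toEuclideanLin_iff]
    ext i j
    simp only [B, Matrix.conjTranspose_apply, Matrix.of_apply, star_trivial, hAsymm j i]
    ring
  have hBapp : ∀ (x : EuclideanSpace ℝ ι) i,
      Matrix.toEuclideanLin B x i = q i * ∑ j, A i j * (q j * x j) := by
    intro x i
    simp only [B, Matrix.toLpLin_apply, Matrix.mulVec, dotProduct, Matrix.of_apply, Finset.mul_sum]
    exact Finset.sum_congr rfl fun j _ => by ring
  have key := inner_map_neg_of_eigenvectors hB (WithLp.toLp 2 q) (by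
    intro a x hx hax
    have hax' : ∀ i, q i * ∑ j, A i j * (q j * x j) = a * x i := fun i => by
      rw [← hBapp, hax]; rfl
    rcases eig a (fun i => q i * x i) (by
        intro h
        apply hx
        ext i
        exact (mul_eq_zero.1 (congrFun h i)).resolve_left (hqpos i).ne') (fun i => by
        rw [← hqq i, mul_assoc, hax' i]; ring) with h | ⟨b, hb⟩
    · exact Or.inl h
    · refine Or.inr ⟨b, ?_⟩
      ext i
      have h1 := hb i
      rw [← hqq i] at h1
      have h2 : q i * x i = q i * (b * q i) := by rw [h1]; ring
      simpa using mul_left_cancel₀ (hqpos i).ne' h2)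
    (WithLp.toLp 2 fun i => w i / q i) (by
      intro h
      apply hw
      ext i
      have : w i / q i = 0 := congrFun (congrArg WithLp.ofLp h) i
      exact (div_eq_zero_iff.1 this).resolve_right (hqpos i).ne') (by
      simp only [PiLp.inner_apply, RCLike.inner_apply, conj_trivial]
      rw [← hsum]
      exact Finset.sum_congr rfl fun i _ => div_mul_cancel₀ _ (hqpos i).ne')
  rw [htri]
  convert key using 1
  simp only [PiLp.inner_apply, RCLike.inner_apply, conj_trivial]
  refine Finset.sum_congr rfl fun i _ => ?_
  have h1 : ∀ j, q j * (w j / q j) = w j := fun j => mul_div_cancel₀ _ (hqpos j).ne'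
  rw [hBapp]
  simp only [h1]
  have := (hqpos i).ne'
  field_simp

/-! ### Determinants and the cubic form of a polygon -/

theorem det3_rotate (a b c : Fin 3 → ℝ) : det3 a b c = det3 b c a := by
  simp only [det3_eq]; ring

theorem det3_swap (a b c : Fin 3 → ℝ) : det3 a b c = -det3 b a c := by
  simp only [det3_eq]; ring

theorem det3_swap_right (a b c : Fin 3 → ℝ) : det3 a b c = -det3 a c b := by
  simp only [det3_eq]; ring

theorem det3_self_left (a b : Fin 3 → ℝ) : det3 a a b = 0 := by
  simp only [det3_eq]; ring

theorem det3_self_right (a b : Fin 3 → ℝ) : det3 a b b = 0 := by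
  simp only [det3_eq]; ring

theorem det3_self_outer (a b : Fin 3 → ℝ) : det3 a b a = 0 := by
  simp only [det3_eq]; ring

/-- Cramer's rule, without division. -/
theorem det3_smul_cramer (a b c m : Fin 3 → ℝ) :
    det3 a b c • m = det3 m b c • a + det3 a m c • b + det3 a b m • c := by
  ext i
  fin_cases i <;> simp [det3_eq] <;> ring

/-- The coefficients `|det (v i, v j, v k)|` of the cubic form, as a totally symmetric array that
vanishes on coinciding indices. -/
def absDet {ι : Type*} (v : ι → Fin 3 → ℝ) (i j k : ι) : ℝ := |det3 (v i) (v j) (v k)|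

theorem absDet_swap_left {ι : Type*} (v : ι → Fin 3 → ℝ) (i j k : ι) :
    absDet v i j k = absDet v j i k := by
  rw [absDet, det3_swap, abs_neg, absDet]

theorem absDet_swap_right {ι : Type*} (v : ι → Fin 3 → ℝ) (i j k : ι) :
    absDet v i j k = absDet v i k j := by
  rw [absDet, det3_swap_right, abs_neg, absDet]

/-- A symmetric array vanishing on coinciding indices sums to six times its sum over increasing
triples. -/
theorem sum_sum_sum_eq_six_mul {ι : Type*} [Fintype ι] [LinearOrder ι] [LocallyFiniteOrderTop ι]
    (f : ι → ι → ι → ℝ)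
    (h12 : ∀ i j k, f i j k = f j i k) (h23 : ∀ i j k, f i j k = f i k j)
    (h0 : ∀ i k, f i i k = 0) :
    ∑ i, ∑ j, ∑ k, f i j k = 6 * ∑ i, ∑ j ∈ Finset.Ioi i, ∑ k ∈ Finset.Ioi j, f i j k := by
  let g : ι → ι → ι → ℝ := fun i j k => if i < j ∧ j < k then f i j k else 0
  have hg : ∑ i, ∑ j ∈ Finset.Ioi i, ∑ k ∈ Finset.Ioi j, f i j k = ∑ i, ∑ j, ∑ k, g i j k := by
    refine Finset.sum_congr rfl fun i _ => ?_
    have : Finset.Ioi i = Finset.univ.filter (i < ·) := by ext; simp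
    rw [this, Finset.sum_filter]
    refine Finset.sum_congr rfl fun j _ => ?_
    have : Finset.Ioi j = Finset.univ.filter (j < ·) := by ext; simp
    rw [this, Finset.sum_filter]
    by_cases hij : i < j <;> simp [g, hij]
  -- the indices of a nonzero term are arranged increasingly by exactly one permutation
  have hf : ∀ i j k, f i j k = g i j k + g i k j + g j i k + g j k i + g k i j + g k j i := by
    intro i j k
    have h0' : ∀ i k, f i k k = 0 := fun i k => by rw [h12, h23, h0]
    have h0'' : ∀ i k, f i k i = 0 := fun i k => by rw [h23, h0]
    rcases eq_or_ne i j with rfl | hij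
    · simp [g, h0, h0'']
    rcases eq_or_ne j k with rfl | hjk
    · simp [g, h0', h0'']
    rcases eq_or_ne i k with rfl | hik
    · simp [g, h0'']
    simp only [g, h12 j i k, h12 k j i, h12 k i j, h23 i k j, h23 j k i]
    rcases hij.lt_or_gt with h | h <;> rcases hjk.lt_or_gt with h' | h' <;>
      rcases hik.lt_or_gt with h'' | h'' <;>
      first
      | (exfalso; order)
      | simp [h, h', h'', h.not_gt, h'.not_gt, h''.not_gt]
  have s23 : ∀ F : ι → ι → ι → ℝ, ∑ i, ∑ j, ∑ k, F i k j = ∑ i, ∑ j, ∑ k, F i j k :=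
    fun F => Finset.sum_congr rfl fun i _ => Finset.sum_comm
  have s12 : ∀ F : ι → ι → ι → ℝ, ∑ i, ∑ j, ∑ k, F j i k = ∑ i, ∑ j, ∑ k, F i j k :=
    fun F => Finset.sum_comm
  rw [hg]
  simp only [hf, Finset.sum_add_distrib]
  have e1 := s23 g
  have e2 := s12 g
  have e3 : ∑ i, ∑ j, ∑ k, g j k i = ∑ i, ∑ j, ∑ k, g i j k :=
    (s12 fun i j k => g i k j).trans e1
  have e4 : ∑ i, ∑ j, ∑ k, g k i j = ∑ i, ∑ j, ∑ k, g i j k :=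
    (s23 fun i j k => g j i k).trans e2
  have e5 : ∑ i, ∑ j, ∑ k, g k j i = ∑ i, ∑ j, ∑ k, g i j k :=
    (s23 fun i j k => g j k i).trans e3
  rw [e1, e2, e3, e4, e5]; ring

theorem FHat_eq_tri {n : ℕ} (v : Fin n → Fin 3 → ℝ) (φ : Fin n → ℝ) :
    FHat v φ = tri (absDet v) φ φ φ / 6 := by
  have := sum_sum_sum_eq_six_mul (fun i j k => absDet v i j k * φ i * φ j * φ k)
    (fun i j k => by rw [absDet_swap_left]; ring) (fun i j k => by rw [absDet_swap_right]; ring)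
    (fun i k => by simp [absDet, det3_self_left])
  rw [eq_div_iff (by norm_num), mul_comm, FHat]
  refine this.symm.trans ?_
  simp only [tri, bil, Finset.mul_sum]
  exact Finset.sum_congr rfl fun i _ => Finset.sum_congr rfl fun j _ =>
    Finset.sum_congr rfl fun k _ => by ring

theorem FHat_add_smul {n : ℕ} (v : Fin n → Fin 3 → ℝ) (φ w : Fin n → ℝ) (t : ℝ) :
    FHat v (φ + t • w) = FHat v φ + t * (tri (absDet v) w φ φ / 2)
      + t ^ 2 * (tri (absDet v) φ w w / 2) + t ^ 3 * FHat v w := by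
  simp only [FHat_eq_tri, tri_add_smul_self (absDet_swap_left v) (absDet_swap_right v)]
  ring

theorem fderiv_FHat {n : ℕ} (v : Fin n → Fin 3 → ℝ) (φ w : Fin n → ℝ) :
    fderiv ℝ (FHat v) φ w = tri (absDet v) w φ φ / 2 := by
  have hd : DifferentiableAt ℝ (FHat v) φ := by
    unfold FHat; fun_prop
  have h1 : HasDerivAt (fun t : ℝ => FHat v (φ + t • w)) (fderiv ℝ (FHat v) φ w) 0 :=
    hd.hasFDerivAt.hasLineDerivAt w
  refine h1.unique ?_
  simp only [FHat_add_smul]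
  have h2 := (((hasDerivAt_id (0 : ℝ)).mul_const (tri (absDet v) w φ φ / 2)).const_add
    (FHat v φ)).add (((hasDerivAt_id (0 : ℝ)).pow 2).mul_const (tri (absDet v) φ w w / 2))
    |>.add (((hasDerivAt_id (0 : ℝ)).pow 3).mul_const (FHat v w))
  refine h2.congr_deriv ?_
  simp

theorem continuous_FHat {n : ℕ} (v : Fin n → Fin 3 → ℝ) : Continuous (FHat v) := by
  unfold FHat; fun_prop

theorem isCompact_simplex (n : ℕ) (r : ℝ) : IsCompact (simplex n r) := by
  refine (isCompact_Icc (a := (0 : Fin n → ℝ)) (b := fun _ => r)).of_isClosed_subset ?_ ?_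
  · have : simplex n r = (⋂ i, {φ : Fin n → ℝ | 0 ≤ φ i}) ∩ {φ | ∑ i, φ i = r} := by
      ext; simp [simplex]
    rw [this]
    exact (isClosed_iInter fun i => isClosed_le continuous_const (continuous_apply i)).inter
      (isClosed_eq (by fun_prop) continuous_const)
  · rintro φ ⟨h0, hr⟩
    refine ⟨h0, fun i => ?_⟩
    rw [← hr]
    exact Finset.single_le_sum (fun j _ => h0 j) (Finset.mem_univ i)

/-! ### Uniqueness of critical points -/

section ordered
variable {n : ℕ} {v : Fin n → Fin 3 → ℝ}

theorem absDet_pos (hord : ∀ i j k, i < j → j < k → 0 < det3 (v i) (v j) (v k)) {i j k : Fin n}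
    (hij : i ≠ j) (hik : i ≠ k) (hjk : j ≠ k) : 0 < absDet v i j k := by
  have key : ∀ i j k, i < j → j < k → 0 < absDet v i j k := fun i j k h h' =>
    abs_pos.2 (hord i j k h h').ne'
  rcases hij.lt_or_gt with h | h <;> rcases hik.lt_or_gt with h' | h' <;>
    rcases hjk.lt_or_gt with h'' | h''
  · exact key _ _ _ h h''
  · rw [absDet_swap_right]; exact key _ _ _ h' h''
  · order
  · rw [absDet_swap_right, absDet_swap_left]; exact key _ _ _ h' h
  · rw [absDet_swap_left]; exact key _ _ _ h h'
  · order
  · rw [absDet_swap_left, absDet_swap_right]; exact key _ _ _ h'' h'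
  · rw [absDet_swap_left, absDet_swap_right, absDet_swap_left]; exact key _ _ _ h'' h

theorem exists_ne_ne (hn : 3 ≤ n) (i j : Fin n) : ∃ k, k ≠ i ∧ k ≠ j := by
  have : (({i, j} : Finset (Fin n))ᶜ).Nonempty := by
    rw [← Finset.card_pos, Finset.card_compl, Fintype.card_fin]
    have := Finset.card_le_two (a := i) (b := j)
    omega
  obtain ⟨k, hk⟩ := this
  exact ⟨k, by simpa [not_or] using hk⟩

/-- At an interior critical point, the Hessian of `FHat v` is negative definite along the
simplex. -/
theorem tri_neg_of_critical (hn : 3 ≤ n)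
    (hord : ∀ i j k, i < j → j < k → 0 < det3 (v i) (v j) (v k))
    {φ : Fin n → ℝ} (hφ : ∀ i, 0 < φ i)
    (hcrit : ∀ w : Fin n → ℝ, ∑ i, w i = 0 → tri (absDet v) w φ φ = 0)
    (w : Fin n → ℝ) (hw : w ≠ 0) (hsum : ∑ i, w i = 0) : tri (absDet v) φ w w < 0 := by
  have : Nontrivial (Fin n) := Fin.nontrivial_iff_two_le.2 (by omega)
  have hpos := fun i j k => absDet_pos hord (i := i) (j := j) (k := k)
  let o : Fin n := ⟨0, by omega⟩
  have hc : ∀ m, bil (absDet v m) φ φ = bil (absDet v o) φ φ := by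
    intro m
    have := hcrit (Pi.single m 1 + (-1 : ℝ) • Pi.single o 1) (by
      simp [Finset.sum_add_distrib])
    rw [tri_add_left, tri_smul_left, tri_single, tri_single] at this
    linarith
  refine tri_neg_of_lorentz (absDet_swap_left v) (absDet_swap_right v) hφ ?_ hc ?_ ?_ w hw hsum
  · obtain ⟨j, hj, -⟩ := exists_ne_ne hn o o
    obtain ⟨k, hk, hkj⟩ := exists_ne_ne hn o j
    exact bil_pos_of_nonneg _ _ (fun _ _ => abs_nonneg _) (hpos o j k hj.symm hk.symm hkj.symm) hφ
  · intro i j hij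
    obtain ⟨k, hki, hkj⟩ := exists_ne_ne hn i j
    exact Finset.sum_pos' (fun k _ => mul_nonneg (abs_nonneg _) (hφ k).le)
      ⟨k, Finset.mem_univ _, mul_pos (hpos i j k hij hki.symm hkj.symm) (hφ k)⟩
  · intro m u hu
    exact bil_det3_lorentz v m
      (fun j k hj hk hjk => abs_pos.1 (hpos m j k hj.symm hk.symm hjk))
      (fun i _ => exists_ne_ne hn m i) ((exists_ne_ne hn m m).imp fun _ h => h.1) φ u hφ hu

/-- The second derivatives of `FHat v` along the segment joining two distinct critical points are
negative at both ends, and their sum is proportional to the difference of the vanishing first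
derivatives at the ends, since `FHat v` is cubic. -/
theorem IsCriticalPoint.eq (hn : 3 ≤ n)
    (hord : ∀ i j k, i < j → j < k → 0 < det3 (v i) (v j) (v k)) {r : ℝ} {φ ψ : Fin n → ℝ}
    (hφ : IsCriticalPoint v r φ) (hψ : IsCriticalPoint v r ψ) : ψ = φ := by
  by_contra hne
  have hcr : ∀ φ, IsCriticalPoint v r φ →
      ∀ w : Fin n → ℝ, ∑ i, w i = 0 → tri (absDet v) w φ φ = 0 := fun φ h w hw => by
    have := h.2 w hw
    rw [fderiv_FHat] at this; linarith
  have hsum : ∑ i, (ψ - φ) i = 0 := by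
    simp [Finset.sum_sub_distrib, hφ.1.2, hψ.1.2]
  have hw : ψ - φ ≠ 0 := sub_ne_zero.2 hne
  have h1 := tri_neg_of_critical hn hord hφ.1.1 (hcr φ hφ) _ hw hsum
  have h2 := tri_neg_of_critical hn hord hψ.1.1 (hcr ψ hψ) _ hw hsum
  have h3 := tri_sub_tri (absDet_swap_left v) (absDet_swap_right v) φ ψ
  rw [hcr φ hφ _ hsum, hcr ψ hψ _ hsum] at h3
  linarith

end ordered

/-! ### First-order conditions and crossing diagonals -/

theorem nonpos_of_cubic_nonpos {a b c ε : ℝ} (hε : 0 < ε)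
    (h : ∀ t, 0 < t → t ≤ ε → t * a + t ^ 2 * b + t ^ 3 * c ≤ 0) : a ≤ 0 := by
  have hlim : Filter.Tendsto (fun t : ℝ => a + t * b + t ^ 2 * c) (nhdsWithin 0 (Set.Ioi 0))
      (nhds a) := by
    have : Continuous fun t : ℝ => a + t * b + t ^ 2 * c := by fun_prop
    simpa using (this.tendsto 0).mono_left nhdsWithin_le_nhds
  refine le_of_tendsto hlim ?_
  filter_upwards [Ioc_mem_nhdsGT hε] with t ht
  refine nonpos_of_mul_nonpos_right (a := t) ?_ ht.1
  linarith [h t ht.1 ht.2]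

/-- The first-order conditions at a maximizer on the simplex: no partial derivative exceeds one at
an index with nonzero coordinate. -/
theorem bil_le_bil_of_isMaxOn {n : ℕ} {v : Fin n → Fin 3 → ℝ} {r : ℝ} {φ : Fin n → ℝ}
    (hφ : φ ∈ simplex n r) (hmax : IsMaxOn (FHat v) (simplex n r) φ) {i : Fin n} (hi : 0 < φ i)
    (m : Fin n) : bil (absDet v m) φ φ ≤ bil (absDet v i) φ φ := by
  rcases eq_or_ne m i with rfl | hmi
  · rfl
  set w : Fin n → ℝ := Pi.single m 1 + (-1 : ℝ) • Pi.single i 1 with hw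
  have hmem : ∀ t, 0 < t → t ≤ φ i → φ + t • w ∈ simplex n r := by
    intro t ht hti
    refine ⟨fun j => ?_, ?_⟩
    · have := hφ.1 j
      simp only [hw, Pi.add_apply, Pi.smul_apply, smul_eq_mul, Pi.single_apply]
      split_ifs <;> subst_vars <;> linarith
    · simp [Finset.sum_add_distrib, hw, ← Finset.mul_sum, hφ.2]
  have h1 : tri (absDet v) w φ φ / 2 ≤ 0 := by
    refine nonpos_of_cubic_nonpos hi (b := tri (absDet v) φ w w / 2) (c := FHat v w)
      fun t ht hti => ?_
    have : FHat v (φ + t • w) ≤ FHat v φ := hmax (hmem t ht hti)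
    rw [FHat_add_smul] at this
    linarith
  rw [hw, tri_add_left, tri_smul_left, tri_single, tri_single] at h1
  linarith

/-- The convex function `x ↦ ∑ |det (x, v j, v k)| φ j φ k` is proportional to the partial
derivative with index `i` at `x = v i`. If the diagonals `v a v b` and `v m v c` cross and no line
through two points of the support of `φ` separates `v a` from `v b`, then its weighted sum over
`v a, v b` is smaller than that over `v m, v c`, by the triangle inequality. -/
theorem bil_lt_of_convex_position {ι : Type*} [Fintype ι] {v : ι → Fin 3 → ℝ} {φ : ι → ℝ}
    (hφ : ∀ i, 0 ≤ φ i) {a b c m : ι} (ha : 0 < φ a) (hb : 0 < φ b) {α β γ δ : ℝ}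
    (hα : 0 ≤ α) (hβ : 0 ≤ β) (hγ : 0 ≤ γ) (hδ : 0 < δ)
    (hrel : δ • v m + γ • v c = α • v a + β • v b)
    (hsign : ∀ j k, 0 < φ j → 0 < φ k →
      0 ≤ det3 (v a) (v j) (v k) * det3 (v b) (v j) (v k))
    (hmab : det3 (v m) (v a) (v b) ≠ 0) :
    α * bil (absDet v a) φ φ + β * bil (absDet v b) φ φ
      < δ * bil (absDet v m) φ φ + γ * bil (absDet v c) φ φ := by
  have hdet : ∀ j k, δ * det3 (v m) (v j) (v k) + γ * det3 (v c) (v j) (v k) =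
      α * det3 (v a) (v j) (v k) + β * det3 (v b) (v j) (v k) := by
    intro j k
    have h0 := congrFun hrel 0
    have h1 := congrFun hrel 1
    have h2 := congrFun hrel 2
    simp only [Pi.add_apply, Pi.smul_apply, smul_eq_mul] at h0 h1 h2
    simp only [det3_eq]
    linear_combination (v j 1 * v k 2 - v k 1 * v j 2) * h0
      + (v k 0 * v j 2 - v j 0 * v k 2) * h1 + (v j 0 * v k 1 - v k 0 * v j 1) * h2
  have hle : ∀ j k, (α * absDet v a j k + β * absDet v b j k) * φ j * φ k ≤
      (δ * absDet v m j k + γ * absDet v c j k) * φ j * φ k := by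
    intro j k
    rcases (hφ j).eq_or_lt with hj | hj
    · simp [← hj]
    rcases (hφ k).eq_or_lt with hk | hk
    · simp [← hk]
    refine mul_le_mul_of_nonneg_right (mul_le_mul_of_nonneg_right ?_ hj.le) hk.le
    have h1 : |α * det3 (v a) (v j) (v k) + β * det3 (v b) (v j) (v k)| =
        α * |det3 (v a) (v j) (v k)| + β * |det3 (v b) (v j) (v k)| := by
      rw [← abs_of_nonneg hα, ← abs_of_nonneg hβ, ← abs_mul, ← abs_mul, abs_of_nonneg hα,
        abs_of_nonneg hβ, abs_add_eq_add_abs_iff]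
      rcases mul_nonneg_iff.1 (hsign j k hj hk) with ⟨h, h'⟩ | ⟨h, h'⟩
      · exact Or.inl ⟨mul_nonneg hα h, mul_nonneg hβ h'⟩
      · exact Or.inr ⟨mul_nonpos_of_nonneg_of_nonpos hα h, mul_nonpos_of_nonneg_of_nonpos hβ h'⟩
    calc α * absDet v a j k + β * absDet v b j k
        = |δ * det3 (v m) (v j) (v k) + γ * det3 (v c) (v j) (v k)| := by rw [hdet, h1]; rfl
      _ ≤ |δ * det3 (v m) (v j) (v k)| + |γ * det3 (v c) (v j) (v k)| := abs_add_le _ _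
      _ = _ := by rw [abs_mul, abs_mul, abs_of_pos hδ, abs_of_nonneg hγ]; rfl
  have hexp : ∀ x y : ℝ, ∀ i j : ι, x * bil (absDet v i) φ φ + y * bil (absDet v j) φ φ =
      ∑ p, ∑ q, (x * absDet v i p q + y * absDet v j p q) * φ p * φ q := by
    intro x y i j
    simp only [bil, Finset.mul_sum, ← Finset.sum_add_distrib]
    exact Finset.sum_congr rfl fun p _ => Finset.sum_congr rfl fun q _ => by ring
  rw [hexp, hexp]
  refine Finset.sum_lt_sum (fun p _ => Finset.sum_le_sum fun q _ => hle p q)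
    ⟨a, Finset.mem_univ _, Finset.sum_lt_sum (fun q _ => hle a q) ⟨b, Finset.mem_univ _, ?_⟩⟩
  -- strictness: the pair `(a, b)` contributes nothing on the left
  have e1 : absDet v a a b = 0 := by simp [absDet, det3_self_left]
  have e2 : absDet v b a b = 0 := by simp [absDet, det3_self_outer]
  rw [e1, e2]
  have e3 : 0 < absDet v m a b := abs_pos.2 hmab
  have e4 : 0 ≤ absDet v c a b := abs_nonneg _
  simp only [mul_zero, add_zero, zero_mul]
  positivity

/-! ### Maximizers lie in the relative interior -/

/-- If `φ m = 0` and the support of `φ` has at least three elements, then `a` and `b` are the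
elements of the support next to `m` in the cyclic order, and `c` is a third element. In the first
case `m` lies between `a` and `b`; in the second `a` and `b` are the extremes of the support. -/
theorem exists_neighbours {n : ℕ} (φ : Fin n → ℝ) (m : Fin n) (hm : φ m = 0)
    {i j k : Fin n} (hij : i < j) (hjk : j < k) (hi : 0 < φ i) (hj : 0 < φ j) (hk : 0 < φ k) :
    ∃ a b c, a < b ∧ 0 < φ a ∧ 0 < φ b ∧ 0 < φ c ∧
      ((a < m ∧ m < b ∧ (c < a ∨ b < c) ∧ ∀ j, 0 < φ j → j ≤ a ∨ b ≤ j) ∨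
       ((m < a ∨ b < m) ∧ a < c ∧ c < b ∧ ∀ j, 0 < φ j → a ≤ j ∧ j ≤ b)) := by
  classical
  have hne : ∀ j, 0 < φ j → j ≠ m := by rintro j hj rfl; exact hj.ne' hm
  let S := Finset.univ.filter fun j => 0 < φ j
  have hS : ∀ j, j ∈ S ↔ 0 < φ j := fun j => by simp [S]
  by_cases hlow : ∃ j, 0 < φ j ∧ j < m
  · by_cases hhigh : ∃ j, 0 < φ j ∧ m < j
    · obtain ⟨x, hx, hxm⟩ := hlow
      obtain ⟨y, hy, hym⟩ := hhigh
      obtain ⟨a, ha, hamax⟩ := (S.filter (· < m)).exists_max_image id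
        ⟨x, by simp [hS, hx, hxm]⟩
      obtain ⟨b, hb, hbmin⟩ := (S.filter (m < ·)).exists_min_image id
        ⟨y, by simp [hS, hy, hym]⟩
      simp only [Finset.mem_filter, hS, id] at ha hb hamax hbmin
      have hgap : ∀ j, 0 < φ j → j ≤ a ∨ b ≤ j := by
        intro j hj
        rcases (hne j hj).lt_or_gt with h | h
        · exact Or.inl (hamax j ⟨hj, h⟩)
        · exact Or.inr (hbmin j ⟨hj, h⟩)
      have hc : ∃ c, 0 < φ c ∧ c ≠ a ∧ c ≠ b := by
        by_contra! hcon
        have h1 := hcon i hi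
        have h2 := hcon j hj
        have h3 := hcon k hk
        grind
      obtain ⟨c, hc, hca, hcb⟩ := hc
      refine ⟨a, b, c, ha.2.trans hb.2, ha.1, hb.1, hc, Or.inl ⟨ha.2, hb.2, ?_, hgap⟩⟩
      rcases hgap c hc with h | h
      · exact Or.inl (lt_of_le_of_ne h hca)
      · exact Or.inr (lt_of_le_of_ne h hcb.symm)
    · obtain ⟨a, ha, hamin⟩ := S.exists_min_image id ⟨i, by simp [hS, hi]⟩
      obtain ⟨b, hb, hbmax⟩ := S.exists_max_image id ⟨i, by simp [hS, hi]⟩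
      simp only [hS, id] at ha hb hamin hbmax
      push Not at hhigh
      have h1 := hamin i hi
      have h2 := hbmax k hk
      refine ⟨a, b, j, by order, ha, hb, hj, Or.inr ⟨Or.inr ?_, by order, by order,
        fun j hj => ⟨hamin j hj, hbmax j hj⟩⟩⟩
      exact lt_of_le_of_ne (hhigh b hb) (hne b hb)
  · obtain ⟨a, ha, hamin⟩ := S.exists_min_image id ⟨i, by simp [hS, hi]⟩
    obtain ⟨b, hb, hbmax⟩ := S.exists_max_image id ⟨i, by simp [hS, hi]⟩
    simp only [hS, id] at ha hb hamin hbmax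
    push Not at hlow
    have h1 := hamin i hi
    have h2 := hbmax k hk
    refine ⟨a, b, j, by order, ha, hb, hj, Or.inr ⟨Or.inl ?_, by order, by order,
      fun j hj => ⟨hamin j hj, hbmax j hj⟩⟩⟩
    exact lt_of_le_of_ne (hlow a ha) (hne a ha).symm

/-- A maximizer has no vanishing coordinate: if `φ m = 0`, the diagonals of the quadrilateral
formed by `v m`, its neighbours in the support and a third vertex of the support cross, and
`bil_lt_of_convex_position` contradicts the first-order conditions. -/
theorem pos_of_isMaxOn {n : ℕ} {v : Fin n → Fin 3 → ℝ}
    (hord : ∀ i j k, i < j → j < k → 0 < det3 (v i) (v j) (v k)) (hheight : ∀ i, v i 2 = 1)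
    {r : ℝ} {φ : Fin n → ℝ} (hφ : φ ∈ simplex n r) (hF : 0 < FHat v φ)
    (hmax : IsMaxOn (FHat v) (simplex n r) φ) (m : Fin n) : 0 < φ m := by
  refine (hφ.1 m).lt_of_ne' fun hm => ?_
  obtain ⟨i, j, k, hij, hjk, hi, hj, hk⟩ :
      ∃ i j k, i < j ∧ j < k ∧ 0 < φ i ∧ 0 < φ j ∧ 0 < φ k := by
    obtain ⟨i, -, h1⟩ := Finset.exists_ne_zero_of_sum_ne_zero hF.ne'
    obtain ⟨j, hj, h2⟩ := Finset.exists_ne_zero_of_sum_ne_zero h1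
    obtain ⟨k, hk, h3⟩ := Finset.exists_ne_zero_of_sum_ne_zero h2
    simp only [ne_eq, mul_eq_zero, not_or] at h3
    exact ⟨i, j, k, by simpa using hj, by simpa using hk, (hφ.1 i).lt_of_ne' h3.1.1.2,
      (hφ.1 j).lt_of_ne' h3.1.2, (hφ.1 k).lt_of_ne' h3.2⟩
  have kkt := fun i hi m => bil_le_bil_of_isMaxOn hφ hmax (i := i) hi m
  have hweak : ∀ i j k, i ≤ j → j ≤ k → 0 ≤ det3 (v i) (v j) (v k) := by
    intro i j k hij hjk
    rcases hij.eq_or_lt with rfl | hij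
    · rw [det3_self_left]
    rcases hjk.eq_or_lt with rfl | hjk
    · rw [det3_self_right]
    exact (hord i j k hij hjk).le
  -- By the first-order conditions the partial derivatives agree at `a`, `b` and are at least those
  -- at `c` and `m`.
  have contra : ∀ a b c, 0 < φ a → 0 < φ b → 0 < φ c → ∀ α β γ δ : ℝ,
      0 ≤ α → 0 ≤ β → 0 ≤ γ → 0 < δ → δ • v m + γ • v c = α • v a + β • v b →
      (∀ j k, j < k → 0 < φ j → 0 < φ k →
        0 ≤ det3 (v a) (v j) (v k) * det3 (v b) (v j) (v k)) →
      det3 (v m) (v a) (v b) ≠ 0 → False := by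
    intro a b c ha hb hc α β γ δ hα hβ hγ hδ hrel hsign hmab
    have hlt := bil_lt_of_convex_position hφ.1 ha hb hα hβ hγ hδ hrel (fun j k hj hk => by
      rcases lt_trichotomy j k with h | rfl | h
      · exact hsign j k h hj hk
      · simp [det3_self_right]
      · rw [det3_swap_right, det3_swap_right (v b), neg_mul_neg]
        exact hsign k j h hk hj) hmab
    have hsum : δ + γ = α + β := by
      have := congrFun hrel 2
      simpa [hheight] using this
    have hab : bil (absDet v b) φ φ = bil (absDet v a) φ φ := (kkt a ha b).antisymm (kkt b hb a)
    have h1 := mul_le_mul_of_nonneg_left (kkt a ha m) hδ.le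
    have h2 := mul_le_mul_of_nonneg_left (kkt a ha c) hγ
    rw [hab, ← add_mul, ← hsum] at hlt
    linarith
  obtain ⟨a, b, c, hab, ha, hb, hc, ⟨ham, hmb, hcab, hgap⟩ | ⟨hm', hac, hcb, hgap⟩⟩ :=
    exists_neighbours φ m hm hij hjk hi hj hk
  · have hcr := det3_smul_cramer (v a) (v b) (v c) (v m)
    have hamb := hord a m b ham hmb
    have eabm := det3_swap_right (v a) (v b) (v m)
    have hsigns : 0 < det3 (v a) (v b) (v c) ∧ 0 < det3 (v m) (v b) (v c) ∧
        0 < det3 (v a) (v m) (v c) := by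
      rcases hcab with h | h
      · rw [← det3_rotate (v c), ← det3_rotate (v c), ← det3_rotate (v c)]
        exact ⟨hord _ _ _ h hab, hord _ _ _ (h.trans ham) hmb, hord _ _ _ h ham⟩
      · exact ⟨hord _ _ _ hab h, hord _ _ _ hmb h, hord _ _ _ ham (hmb.trans h)⟩
    obtain ⟨s1, s2, s3⟩ := hsigns
    refine contra a b c ha hb hc _ _ _ _ s2.le s3.le hamb.le s1 ?_ ?_ ?_
    · rw [hcr, eabm, neg_smul]; abel
    · intro j k hjk hj hk
      rcases hgap j hj with h | h
      · rcases hgap k hk with h' | h'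
        · rw [det3_rotate, det3_rotate (v b)]
          exact mul_nonneg (hweak _ _ _ hjk.le h') (hweak _ _ _ hjk.le (by order))
        · rw [det3_swap, det3_swap (v b), neg_mul_neg]
          exact mul_nonneg (hweak _ _ _ h (by order)) (hweak _ _ _ (by order) h')
      · exact mul_nonneg (hweak _ _ _ (by order) hjk.le) (hweak _ _ _ h hjk.le)
    · rw [det3_swap]; exact neg_ne_zero.2 hamb.ne'
  · have hcr := det3_smul_cramer (v a) (v c) (v b) (v m)
    have s1 := hord a c b hac hcb
    have hsigns : 0 < det3 (v a) (v b) (v m) ∧ 0 < det3 (v m) (v c) (v b) ∧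
        0 < det3 (v a) (v c) (v m) := by
      rcases hm' with h | h
      · rw [← det3_rotate (v m) (v a), ← det3_rotate (v m) (v a)]
        exact ⟨hord _ _ _ h hab, hord _ _ _ (h.trans hac) hcb, hord _ _ _ h hac⟩
      · rw [det3_rotate (v m)]
        exact ⟨hord _ _ _ hab h, hord _ _ _ hcb h, hord _ _ _ hac (hcb.trans h)⟩
    obtain ⟨s4, s2, s3⟩ := hsigns
    refine contra a b c ha hb hc _ _ _ _ s2.le s3.le s4.le s1 ?_ ?_ ?_
    · rw [hcr, det3_swap_right (v a) (v m) (v b), neg_smul]; abel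
    · intro j k hjk hj hk
      rw [det3_rotate (v b)]
      exact mul_nonneg (hweak _ _ _ (hgap j hj).1 hjk.le) (hweak _ _ _ hjk.le (hgap k hk).2)
    · rw [det3_rotate]; exact s4.ne'

/-! ### Toric diagrams and their automorphisms -/

theorem IsToricDiagram.eq_convexHull_range {P : Set (Fin 3 → ℝ)} (hP : IsToricDiagram P) {n : ℕ}
    {v : Fin n → Fin 3 → ℝ} (hv : IsVertexList P v) : P = convexHull ℝ (Set.range v) := by
  obtain ⟨⟨S, hS, -, rfl⟩, -⟩ := hP
  have h := closure_convexHull_extremePoints ((hS.image _).isCompact_convexHull ℝ)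
    (convex_convexHull ℝ ((fun (x : Fin 3 → ℤ) (i : Fin 3) => (x i : ℝ)) '' S))
  rw [← hv.1, ((Set.finite_range v).isClosed_convexHull ℝ).closure_eq] at h
  exact h.symm

theorem IsToricDiagram.three_le {P : Set (Fin 3 → ℝ)} (hP : IsToricDiagram P) {n : ℕ}
    {v : Fin n → Fin 3 → ℝ} (hv : IsVertexList P v) : 3 ≤ n := by
  have h2 := hP.2
  rw [hP.eq_convexHull_range hv, ← direction_affineSpan, affineSpan_convexHull,
    direction_affineSpan] at h2
  rcases Nat.eq_zero_or_pos n with rfl | hn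
  · rw [Set.range_eq_empty, vectorSpan_empty, finrank_bot] at h2
    omega
  · have : Nonempty (Fin n) := ⟨⟨0, hn⟩⟩
    have := finrank_vectorSpan_range_add_one_le ℝ v
    rw [h2, Fintype.card_fin] at this
    exact this

theorem IsToricDiagram.height_eq_one {P : Set (Fin 3 → ℝ)} (hP : IsToricDiagram P)
    {x : Fin 3 → ℝ} (hx : x ∈ P) : x 2 = 1 := by
  obtain ⟨⟨S, -, hS, rfl⟩, -⟩ := hP
  have hconv : Convex ℝ {x : Fin 3 → ℝ | x 2 = 1} :=
    convex_hyperplane (f := fun x : Fin 3 → ℝ => x 2) ⟨fun _ _ => rfl, fun _ _ => rfl⟩ 1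
  refine convexHull_min ?_ hconv hx
  rintro _ ⟨y, hy, rfl⟩
  have : y 2 = 1 := hS hy
  simp [this]

theorem injective_of_ordered {n : ℕ} (hn : 3 ≤ n) {v : Fin n → Fin 3 → ℝ}
    (hord : ∀ i j k, i < j → j < k → 0 < det3 (v i) (v j) (v k)) : Function.Injective v := by
  intro i j hij
  by_contra hne
  obtain ⟨k, hki, hkj⟩ := exists_ne_ne hn i j
  have := absDet_pos hord hne hki.symm hkj.symm
  rw [absDet, hij, det3_self_left, abs_zero] at this
  exact this.false

theorem act_act_inv (g : GL (Fin 3) ℤ) (x : Fin 3 → ℝ) : act g (act g⁻¹ x) = x := by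
  have h := (Int.castRingHom ℝ).mapMatrix.map_mul g.1 (g⁻¹).1
  rw [← Units.val_mul, mul_inv_cancel, Units.val_one, map_one] at h
  rw [act, act, Matrix.mulVec_mulVec]
  exact (congrArg (fun A : Matrix (Fin 3) (Fin 3) ℝ => A.mulVec x) h.symm).trans
    (Matrix.one_mulVec x)

/-- The action `act g` of `g ∈ GL(3, ℤ)` on `ℝ³` as a linear automorphism. -/
def actEquiv (g : GL (Fin 3) ℤ) : (Fin 3 → ℝ) ≃ₗ[ℝ] (Fin 3 → ℝ) where
  toFun := act g
  invFun := act g⁻¹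
  map_add' x y := Matrix.mulVec_add _ x y
  map_smul' a x := Matrix.mulVec_smul _ a x
  left_inv x := by simpa using act_act_inv g⁻¹ x
  right_inv x := act_act_inv g x

theorem abs_det3_act (g : GL (Fin 3) ℤ) (x y z : Fin 3 → ℝ) :
    |det3 (act g x) (act g y) (act g z)| = |det3 x y z| := by
  have h : Matrix.transpose (Matrix.of ![act g x, act g y, act g z]) =
      g.1.map (fun a : ℤ => (a : ℝ)) * Matrix.transpose (Matrix.of ![x, y, z]) := by
    ext i j
    fin_cases j <;> simp [act, Matrix.mul_apply, Matrix.mulVec, dotProduct]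
  have hdet : |(g.1.map (fun a : ℤ => (a : ℝ))).det| = 1 := by
    have h1 : (g.1.map (fun a : ℤ => (a : ℝ))).det = (g.1.det : ℝ) :=
      ((Int.castRingHom ℝ).map_det g.1).symm
    rw [h1, ← Int.cast_abs, Int.isUnit_iff_abs_eq.1 (Matrix.isUnits_det_units g)]
    simp
  rw [det3, h, Matrix.det_mul, abs_mul, hdet, one_mul, det3]

theorem exists_perm_of_act_image_eq {P : Set (Fin 3 → ℝ)} {n : ℕ} {v : Fin n → Fin 3 → ℝ}
    (hv : Set.range v = P.extremePoints ℝ) (hinj : Function.Injective v) {g : GL (Fin 3) ℤ}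
    (hg : act g '' P = P) : ∃ σ : Equiv.Perm (Fin n), ∀ i, act g (v i) = v (σ i) := by
  have himg : act g '' P.extremePoints ℝ = P.extremePoints ℝ := by
    have := image_extremePoints (𝕜 := ℝ) (actEquiv g) P
    change act g '' _ = (act g '' P).extremePoints ℝ at this
    rwa [hg] at this
  have hex : ∀ i, ∃ j, act g (v i) = v j := fun i => by
    have : act g (v i) ∈ Set.range v := by
      rw [hv, ← himg, ← hv]
      exact ⟨v i, ⟨i, rfl⟩, rfl⟩
    exact this.imp fun _ h => h.symm
  choose s hs using hex
  have hsinj : Function.Injective s := fun i j hij => by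
    apply hinj
    apply (actEquiv g).injective
    exact (hs i).trans ((congrArg v hij).trans (hs j).symm)
  exact ⟨Equiv.ofBijective s (Finite.injective_iff_bijective.1 hsinj), hs⟩

/-! ### The unique maximizer and its symmetry -/

theorem FHat_permCoords {n : ℕ} {v : Fin n → Fin 3 → ℝ} {σ : Equiv.Perm (Fin n)}
    (hσ : ∀ i j k, absDet v (σ i) (σ j) (σ k) = absDet v i j k) (φ : Fin n → ℝ) :
    FHat v (permCoords σ φ) = FHat v φ := by
  rw [FHat_eq_tri, FHat_eq_tri]
  congr 1
  simp only [tri, bil]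
  rw [← Equiv.sum_comp σ]
  refine Finset.sum_congr rfl fun i _ => ?_
  rw [← Equiv.sum_comp σ]
  simp only [permCoords, Equiv.symm_apply_apply]
  congr 1
  refine Finset.sum_congr rfl fun j _ => ?_
  rw [← Equiv.sum_comp σ]
  simp only [Equiv.symm_apply_apply, hσ]

theorem permCoords_mem_simplex {n : ℕ} {r : ℝ} (σ : Equiv.Perm (Fin n)) {φ : Fin n → ℝ}
    (hφ : φ ∈ simplex n r) : permCoords σ φ ∈ simplex n r :=
  ⟨fun _ => hφ.1 _, (Equiv.sum_comp σ.symm φ).trans hφ.2⟩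

theorem isCriticalPoint_of_isMaxOn {n : ℕ} {v : Fin n → Fin 3 → ℝ} {r : ℝ} {φ : Fin n → ℝ}
    (hφ : φ ∈ relintSimplex n r) (hmax : IsMaxOn (FHat v) (simplex n r) φ) :
    IsCriticalPoint v r φ := by
  refine ⟨hφ, fun w hw => ?_⟩
  have hφ' : φ ∈ simplex n r := ⟨fun i => (hφ.1 i).le, hφ.2⟩
  have hconst : ∀ i j, bil (absDet v i) φ φ = bil (absDet v j) φ φ := fun i j =>
    (bil_le_bil_of_isMaxOn hφ' hmax (hφ.1 j) i).antisymm
      (bil_le_bil_of_isMaxOn hφ' hmax (hφ.1 i) j)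
  rw [fderiv_FHat, tri, div_eq_zero_iff]
  left
  rcases isEmpty_or_nonempty (Fin n) with h | ⟨⟨o⟩⟩
  · simp
  · simp only [hconst _ o, ← Finset.sum_mul, hw, zero_mul]

theorem exists_unique_maximizer {n : ℕ} (hn : 3 ≤ n) {v : Fin n → Fin 3 → ℝ}
    (hord : ∀ i j k, i < j → j < k → 0 < det3 (v i) (v j) (v k)) (hheight : ∀ i, v i 2 = 1)
    {r : ℝ} (hr : 0 < r) :
    ∃ φ, IsCriticalPoint v r φ ∧ (∀ ψ, IsCriticalPoint v r ψ → ψ = φ) ∧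
      ∀ ψ ∈ simplex n r, ψ ≠ φ → FHat v ψ < FHat v φ := by
  have hn0 : (0 : ℝ) < n := by exact_mod_cast (by omega : 0 < n)
  -- the barycentre shows that the maximum is positive
  let u : Fin n → ℝ := fun _ => r / n
  have hupos : ∀ i, 0 < u i := fun _ => div_pos hr hn0
  have hu : u ∈ simplex n r := ⟨fun i => (hupos i).le, by simp [u]; field_simp⟩
  have hFu : 0 < FHat v u := by
    have hnn : ∀ i j k, 0 ≤ |det3 (v i) (v j) (v k)| * u i * u j * u k := fun i j k =>
      mul_nonneg (mul_nonneg (mul_nonneg (abs_nonneg _) (hupos i).le) (hupos j).le) (hupos k).le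
    let i : Fin n := ⟨0, by omega⟩
    let j : Fin n := ⟨1, by omega⟩
    let k : Fin n := ⟨2, by omega⟩
    have hij : i < j := by simp [i, j]
    have hjk : j < k := by simp [j, k]
    refine Finset.sum_pos' (fun i _ => Finset.sum_nonneg fun j _ => Finset.sum_nonneg fun k _ =>
      hnn i j k) ⟨i, Finset.mem_univ _, Finset.sum_pos' (fun j _ => Finset.sum_nonneg fun k _ =>
      hnn i j k) ⟨j, Finset.mem_Ioi.2 hij, Finset.sum_pos' (fun k _ => hnn i j k)
      ⟨k, Finset.mem_Ioi.2 hjk, ?_⟩⟩⟩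
    exact mul_pos (mul_pos (mul_pos (abs_pos.2 (hord i j k hij hjk).ne') (hupos i)) (hupos j))
      (hupos k)
  have hcrit : ∀ φ ∈ simplex n r, IsMaxOn (FHat v) (simplex n r) φ → IsCriticalPoint v r φ :=
    fun φ hφ hmax => isCriticalPoint_of_isMaxOn
      ⟨pos_of_isMaxOn hord hheight hφ (hFu.trans_le (hmax hu)) hmax, hφ.2⟩ hmax
  obtain ⟨φ, hφ, hmax⟩ := (isCompact_simplex n r).exists_isMaxOn ⟨u, hu⟩
    (continuous_FHat v).continuousOn
  have hφc := hcrit φ hφ hmax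
  refine ⟨φ, hφc, fun ψ hψ => hφc.eq hn hord hψ, fun ψ hψ hne => ?_⟩
  refine (hmax hψ).lt_of_ne fun heq => hne ?_
  refine hφc.eq hn hord (hcrit ψ hψ fun x hx => ?_)
  rw [Set.mem_ofPred_eq, heq]
  exact hmax hx

end ToricA

theorem mainTheorem4 (P : Set (Fin 3 → ℝ)) (hP : ToricA.IsToricDiagram P)
    (n : ℕ) (v : Fin n → Fin 3 → ℝ) (hv : ToricA.IsVertexList P v)
    (r : ℝ) (hr : 0 < r)
    (g : GL (Fin 3) ℤ) (hg : g ∈ ToricA.affineGroup) (hg1 : g ≠ 1)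
    (hgP : ToricA.act g '' P = P) :
    ∃ σ : Equiv.Perm (Fin n), (∀ i, ToricA.act g (v i) = v (σ i)) ∧
      ∃ φ : Fin n → ℝ,
        ToricA.IsCriticalPoint v r φ ∧
        (∀ ψ, ToricA.IsCriticalPoint v r ψ → ψ = φ) ∧
        (∀ ψ ∈ ToricA.simplex n r, ψ ≠ φ → ToricA.FHat v ψ < ToricA.FHat v φ) ∧
        ToricA.permCoords σ φ = φ := by
  have hn := hP.three_le hv
  have hheight : ∀ i, v i 2 = 1 := fun i =>
    hP.height_eq_one (extremePoints_subset (hv.1 ▸ Set.mem_range_self i))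
  obtain ⟨σ, hσ⟩ :=
    ToricA.exists_perm_of_act_image_eq hv.1 (ToricA.injective_of_ordered hn hv.2) hgP
  obtain ⟨φ, hφ, huniq, hmax⟩ := ToricA.exists_unique_maximizer hn hv.2 hheight hr
  refine ⟨σ, hσ, φ, hφ, huniq, hmax, ?_⟩
  -- the permuted maximizer is a maximizer
  by_contra hne
  refine (hmax _ (ToricA.permCoords_mem_simplex σ ⟨fun i => (hφ.1.1 i).le, hφ.1.2⟩) hne).ne
    (ToricA.FHat_permCoords (fun i j k => ?_) φ)
  rw [ToricA.absDet, ← hσ, ← hσ, ← hσ, ToricA.abs_det3_act, ToricA.absDet]
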